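/- Let $f:\mathbb R^n\to\mathbb R$ and $g:\mathbb R^m\to\mathbb R$ be lower semicontinuous and bounded below, and let $H:\mathbb R^n\times\mathbb R^m\to\mathbb R$ be differentiable with $l$-Lipschitz gradient, $l>0$, for the Euclidean norms. Put $\Psi(x,y)=f(x)+g(y)+H(x,y)$. For a function $\varphi$ on a Euclidean space, the Fréchet subdifferential $\hat\partial\varphi(x)$ is the set of $v$ with $\liminf_{y\to x,\,y\ne x}\frac{\varphi(y)-\varphi(x)-\langle v,y-x\rangle}{\|y-x\|}\ge 0$, and the limiting subdifferential $\partial\varphi(x)$ is the set of limits of sequences $v_j\in\hat\partial\varphi(x_j)$ with $x_j\to x$ and $\varphi(x_j)\to\varphi(x)$; a point $x$ with $0\in\partial\varphi(x)$ is called critical. Assume that $\Psi$ is a Kurdyka–Łojasiewicz (KL) function: for every $u$ with $\partial\Psi(u)\ne\emptyset$ there are $\eta\in(0,\infty)$, a neighbourhood $S$ of $u$ and a continuous concave function $\phi:[0,\eta)\to[0,\infty)$ with $\phi(0)=0$ that is $C^1$ with $\phi'>0$ on $(0,\eta)$, such that $\phi'(\Psi(z)-\Psi(u))\cdot\operatorname{dist}(0,\partial\Psi(z))\ge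 1$ for all $z\in S$ with $\Psi(u)<\Psi(z)<\Psi(u)+\eta$ (where $\operatorname{dist}(0,\emptyset)=+\infty$). Let $\gamma>1$, $\tau=\frac{1}{\gamma l}$, and let $z^k=(x^k,y^k)$, $k\ge 0$, be any bounded sequence with $$x^{k+1}\in\operatorname{prox}_{\tau f}\bigl(x^k-\tau\nabla_xH(x^k,y^k)\bigr),\qquad y^{k+1}\in\operatorname{prox}_{\tau g}\bigl(y^k-\tau\nabla_yH(x^{k+1},y^k)\bigr)$$ for all $k\ge 0$, where $\operatorname{prox}_{h}(w)=\operatorname{argmin}_u\{h(u)+\tfrac12\|u-w\|^2\}$ is the (possibly multivalued) proximal operator. Then: 1. $\sum_{k}\|z^{k+1}-z^k\|<\infty$; 2. $(z^k)$ converges to a critical point of $\Psi$, that is, to some $z^*$ with $0\in\partial\Psi(z^*)$. -/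

import Mathlib

namespace PALM

open Set Filter Topology

noncomputable section

section Subdifferential

variable {E : Type*} [NormedAddCommGroup E] [InnerProductSpace ℝ E]

/-- The Fréchet subdifferential of `f` at `x`: all `v` with
`liminf_{y → x, y ≠ x} (f y - f x - ⟪v, y - x⟫) / ‖y - x‖ ≥ 0`.
The lower limit is taken in the extended reals. -/
def frechetSubdifferential (f : E → ℝ) (x : E) : Set E :=
  {v | 0 ≤ liminf (fun y => (((f y - f x - inner ℝ v (y - x)) / ‖y - x‖ : ℝ) : EReal)) (𝓝[≠] x)}

/-- The limiting subdifferential of `f` at `x`: limits of Fréchet subgradients `v n` at points `u n`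
with `u n → x` and `f (u n) → f x`. -/
def limitingSubdifferential (f : E → ℝ) (x : E) : Set E :=
  {v₀ | ∃ u v : ℕ → E, Tendsto u atTop (𝓝 x) ∧ Tendsto (fun n => f (u n)) atTop (𝓝 (f x)) ∧
    (∀ n, v n ∈ frechetSubdifferential f (u n)) ∧ Tendsto v atTop (𝓝 v₀)}

/-- The critical points of `f`, in the sense of the limiting subdifferential. -/
def criticalPoints (f : E → ℝ) : Set E := {x | 0 ∈ limitingSubdifferential f x}

/-- The class `Φ_η` of desingularizing functions `φ : [0, η) → [0, ∞)`. A member is represented by a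
function on `ℝ`; its values outside `[0, η)` play no role. -/
structure IsDesingularizing (η : ℝ) (φ : ℝ → ℝ) : Prop where
  nonneg : ∀ t ∈ Ico 0 η, 0 ≤ φ t
  continuousOn : ContinuousOn φ (Ico 0 η)
  concaveOn : ConcaveOn ℝ (Ico 0 η) φ
  map_zero : φ 0 = 0
  contDiffOn : ContDiffOn ℝ 1 φ (Ioo 0 η)
  deriv_pos : ∀ t ∈ Ioo 0 η, 0 < deriv φ t

/-- The Kurdyka–Łojasiewicz property of `f` at `u`. The distance from `0` to `∂f(x)` is extended
valued, equal to `∞` when `∂f(x)` is empty. -/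
def HasKLPropertyAt (f : E → ℝ) (u : E) : Prop :=
  ∃ η : ℝ, 0 < η ∧ ∃ S ∈ 𝓝 u, ∃ φ : ℝ → ℝ, IsDesingularizing η φ ∧
    ∀ x ∈ S, f u < f x → f x < f u + η →
      1 ≤ ENNReal.ofReal (deriv φ (f x - f u)) * Metric.infEDist 0 (limitingSubdifferential f x)

/-- `f` is a KL function: it has the KL property at every point of `dom ∂f`. -/
def IsKLFunction (f : E → ℝ) : Prop :=
  ∀ u, (limitingSubdifferential f u).Nonempty → HasKLPropertyAt f u

/-- The set-valued proximal operator `prox_f(x) = argmin_u { f u + ‖u - x‖² / 2 }`. -/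
def prox (f : E → ℝ) (x : E) : Set E :=
  {p | ∀ u, f p + 1 / 2 * ‖p - x‖ ^ 2 ≤ f u + 1 / 2 * ‖u - x‖ ^ 2}

end Subdifferential

section Algorithm

variable {E F : Type*} [NormedAddCommGroup E] [InnerProductSpace ℝ E]
  [NormedAddCommGroup F] [InnerProductSpace ℝ F]

/-- The objective `Ψ(x, y) = f x + g y + H (x, y)` on the Hilbert product `E × F`. -/
def objective (f : E → ℝ) (g : F → ℝ) (H : WithLp 2 (E × F) → ℝ) (z : WithLp 2 (E × F)) : ℝ :=
  f z.fst + g z.snd + H z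

/-- The partial gradient `∇ₓ H(x, y)`. -/
def gradFst [CompleteSpace E] (H : WithLp 2 (E × F) → ℝ) (x : E) (y : F) : E :=
  gradient (fun x' => H (WithLp.toLp 2 (x', y))) x

/-- The partial gradient `∇_y H(x, y)`. -/
def gradSnd [CompleteSpace F] (H : WithLp 2 (E × F) → ℝ) (x : E) (y : F) : F :=
  gradient (fun y' => H (WithLp.toLp 2 (x, y'))) y

/-- `(x k, y k)` is generated by proximal alternating linearized minimization with step sizes
`c k`, `d k`; each update is an arbitrary element of the proximal set. -/
structure IsIteration [CompleteSpace E] [CompleteSpace F] (f : E → ℝ) (g : F → ℝ)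
    (H : WithLp 2 (E × F) → ℝ) (c d : ℕ → ℝ) (x : ℕ → E) (y : ℕ → F) : Prop where
  step_fst : ∀ k, x (k + 1) ∈ prox (c k • f) (x k - c k • gradFst H (x k) (y k))
  step_snd : ∀ k, y (k + 1) ∈ prox (d k • g) (y k - d k • gradSnd H (x (k + 1)) (y k))

end Algorithm

end

end PALM

namespace PALM

open Set Filter Topology

/-! ### Subgradients and proximal inequalities -/

section Subdifferential

variable {E : Type*} [NormedAddCommGroup E] [InnerProductSpace ℝ E]

/-! Three facts about the iterates drive the proof. Prox minimality and the descent lemma give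
sufficient decrease: `Ψ` drops by at least `(γ - 1) * l / 2` times the squared step
(`objective_decrease`). The prox optimality conditions give a subgradient at the new iterate of norm
at most a constant times the step (`exists_subgradient_norm_le`). Along convergent subsequences the
values of `Ψ` converge to its value at the limit (`objective_eq_of_tendsto_subseq`), so every
cluster point is critical.

The KL inequality at a cluster point then makes each step at most half the previous one plus a
telescoping term (`IsDesingularizing.two_mul_le`). Started close enough to the cluster point, the
sequence never leaves the KL neighbourhood, so its length is finite and it is Cauchy
(`summable_dist_of_trapped`). -/

theorem mem_frechetSubdifferential_of_eventually {f : E → ℝ} {x v : E}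
    (h : ∀ ε > 0, ∀ᶠ y in 𝓝 x, -(ε * ‖y - x‖) ≤ f y - f x - inner ℝ v (y - x)) :
    v ∈ frechetSubdifferential f x := by
  change (0 : EReal) ≤ _
  refine le_of_forall_lt fun a ha => ?_
  obtain ⟨b, hab, hb⟩ := EReal.lt_iff_exists_real_btwn.1 ha
  have hb' : b < 0 := by exact_mod_cast hb
  refine hab.trans_le (le_liminf_of_le (by isBoundedDefault) ?_)
  filter_upwards [nhdsWithin_le_nhds (h (-b) (by linarith)), self_mem_nhdsWithin] with y hy hne
  have hpos : 0 < ‖y - x‖ := norm_pos_iff.2 (sub_ne_zero.2 hne)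
  rw [EReal.coe_le_coe_iff, le_div_iff₀ hpos]
  linarith

theorem frechetSubdifferential_subset_limitingSubdifferential (f : E → ℝ) (x : E) :
    frechetSubdifferential f x ⊆ limitingSubdifferential f x := fun v hv =>
  ⟨fun _ => x, fun _ => v, tendsto_const_nhds, tendsto_const_nhds, fun _ => hv,
    tendsto_const_nhds⟩

/-- A point of the proximal set of `c • f` satisfies a quadratic lower bound on `f`. -/
theorem le_of_mem_prox {f : E → ℝ} {c : ℝ} (hc : 0 < c) {w p : E} (hp : p ∈ prox (c • f) w)
    (u : E) :
    f p + inner ℝ (c⁻¹ • (w - p)) (u - p) - c⁻¹ / 2 * ‖u - p‖ ^ 2 ≤ f u := by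
  have h := hp u
  simp only [Pi.smul_apply, smul_eq_mul] at h
  have e : ‖u - w‖ ^ 2 = ‖u - p‖ ^ 2 - 2 * inner ℝ (w - p) (u - p) + ‖p - w‖ ^ 2 := by
    have h1 : u - w = (u - p) - (w - p) := by abel
    rw [h1, norm_sub_sq_real, real_inner_comm, norm_sub_rev w p]
  rw [inner_smul_left]
  simp only [conj_trivial]
  have h2 : c * (f p + c⁻¹ * inner ℝ (w - p) (u - p) - c⁻¹ / 2 * ‖u - p‖ ^ 2) ≤ c * f u := by
    have h3 : c * (f p + c⁻¹ * inner ℝ (w - p) (u - p) - c⁻¹ / 2 * ‖u - p‖ ^ 2) =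
        c * f p + inner ℝ (w - p) (u - p) - 1 / 2 * ‖u - p‖ ^ 2 := by
      field_simp
    rw [h3]
    linarith
  exact le_of_mul_le_mul_left h2 hc

/-- The sufficient decrease of a proximal gradient step on the nonsmooth part. -/
theorem prox_gradient_decrease {f : E → ℝ} {c : ℝ} (hc : 0 < c) {x p q : E}
    (hp : p ∈ prox (c • f) (x - c • q)) :
    f p + inner ℝ q (p - x) + c⁻¹ / 2 * ‖p - x‖ ^ 2 ≤ f x := by
  refine le_trans (le_of_eq ?_) (le_of_mem_prox hc hp x)
  have e : c⁻¹ • (x - c • q - p) = c⁻¹ • (x - p) - q := by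
    rw [sub_right_comm, smul_sub, smul_smul, inv_mul_cancel₀ hc.ne', one_smul]
  rw [e, inner_sub_left, inner_smul_left, real_inner_self_eq_norm_sq, norm_sub_rev x p,
    ← neg_sub p x, inner_neg_right]
  simp only [conj_trivial]
  ring

end Subdifferential

/-! ### Descent lemma -/

section Smooth

variable {E : Type*} [NormedAddCommGroup E] [InnerProductSpace ℝ E] [CompleteSpace E]

/-- The descent lemma for functions with Lipschitz gradient. -/
theorem le_add_inner_gradient_add_sq {H : E → ℝ} {l : NNReal} (hH : Differentiable ℝ H)
    (hl : LipschitzWith l (gradient H)) (u v : E) :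
    H v ≤ H u + inner ℝ (gradient H u) (v - u) + l / 2 * ‖v - u‖ ^ 2 := by
  set D : E := v - u with hD
  -- `H` on the segment minus its quadratic upper model. The Lipschitz gradient makes this antitone
  -- on `[0, 1]`, and comparing the endpoints gives the claim.
  let φ : ℝ → ℝ := fun t => H (u + t • D) - t * inner ℝ (gradient H u) D - l / 2 * ‖D‖ ^ 2 * t ^ 2
  have hφ : ∀ t, HasDerivAt φ (inner ℝ (gradient H (u + t • D)) D - inner ℝ (gradient H u) D
      - l * ‖D‖ ^ 2 * t) t := by
    intro t
    have h1 : HasDerivAt (fun t : ℝ => u + t • D) D t := by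
      simpa using ((hasDerivAt_id t).smul_const D).const_add u
    have h2 := (hH (u + t • D)).hasGradientAt.hasFDerivAt.comp_hasDerivAt t h1
    have h3 := (hasDerivAt_id t).mul_const (inner ℝ (gradient H u) D)
    have h4 := ((hasDerivAt_id t).pow 2).const_mul (l / 2 * ‖D‖ ^ 2)
    refine ((h2.sub h3).sub h4).congr_deriv ?_
    simp
    ring
  have hanti : AntitoneOn φ (Icc 0 1) := by
    refine antitoneOn_of_deriv_nonpos (convex_Icc 0 1)
      (fun t _ => (hφ t).continuousAt.continuousWithinAt)
      (fun t _ => (hφ t).differentiableAt.differentiableWithinAt) fun t ht => ?_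
    rw [interior_Icc] at ht
    rw [(hφ t).deriv, ← inner_sub_left]
    have h5 := real_inner_le_norm (gradient H (u + t • D) - gradient H u) D
    have h6 := hl.dist_le_mul (u + t • D) u
    rw [dist_eq_norm, dist_eq_norm, add_sub_cancel_left, norm_smul, Real.norm_eq_abs,
      abs_of_pos ht.1] at h6
    have h7 := mul_le_mul_of_nonneg_right h6 (norm_nonneg D)
    nlinarith
  have := hanti (left_mem_Icc.2 zero_le_one) (right_mem_Icc.2 zero_le_one) zero_le_one
  simp only [φ, one_smul, zero_smul, add_zero, hD, add_sub_cancel] at this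
  linarith

end Smooth

/-! ### Abstract KL convergence -/

section Convergence

/-- By concavity the slope over `[s, t]` is at least the derivative at the right end. The case `s =
0` is included, since the values may reach their limit. -/
theorem IsDesingularizing.deriv_mul_sub_le {η : ℝ} {φ : ℝ → ℝ} (hφ : IsDesingularizing η φ)
    {s t : ℝ} (ht : t ∈ Ioo 0 η) (hs : 0 ≤ s) (hst : s ≤ t) :
    deriv φ t * (t - s) ≤ φ t - φ s := by
  rcases hst.eq_or_lt with rfl | hlt
  · simp
  have hd : DifferentiableAt ℝ φ t :=
    (hφ.contDiffOn.differentiableOn one_ne_zero).differentiableAt (isOpen_Ioo.mem_nhds ht)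
  have := hφ.concaveOn.deriv_le_slope ⟨hs, hlt.trans ht.2⟩ ⟨ht.1.le, ht.2⟩ hlt hd
  rwa [slope_def_field, le_div_iff₀ (sub_pos.2 hlt)] at this

/-- A sequence whose steps contract, up to a telescoping error, as long as it stays in a ball is
trapped in that ball and has finite length. -/
theorem summable_dist_of_trapped {X : Type*} [PseudoMetricSpace X] {z : ℕ → X} {w : X} {ρ : ℝ}
    {θ : ℕ → ℝ} (hθ : ∀ k, 0 ≤ θ k)
    (hstart : dist (z 1) w + dist (z 1) (z 0) + θ 1 < ρ)
    (hstep : ∀ k, dist (z (k + 1)) w < ρ →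
      2 * dist (z (k + 2)) (z (k + 1)) ≤ dist (z (k + 1)) (z k) + (θ (k + 1) - θ (k + 2))) :
    Summable fun k => dist (z (k + 1)) (z k) := by
  -- Of the two copies of the new step in `hstep`, one extends the sum and the other replaces the
  -- last step in the invariant. The resulting bound on the sum keeps the next point in the ball.
  have key : ∀ n, dist (z (n + 1)) w ≤
        dist (z 1) w + ∑ i ∈ Finset.range n, dist (z (i + 2)) (z (i + 1)) ∧
      ∑ i ∈ Finset.range n, dist (z (i + 2)) (z (i + 1)) + dist (z (n + 1)) (z n) + θ (n + 1) ≤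
        dist (z 1) (z 0) + θ 1 := by
    intro n
    induction n with
    | zero => simp
    | succ n ih =>
      obtain ⟨h1, h2⟩ := ih
      have hz : dist (z (n + 1)) w < ρ := by
        linarith [hθ (n + 1), dist_nonneg (x := z (n + 1)) (y := z n)]
      rw [Finset.sum_range_succ]
      exact ⟨by linarith [dist_triangle (z (n + 2)) (z (n + 1)) w],
        by linarith [hstep n hz]⟩
  rw [← summable_nat_add_iff 1]
  refine summable_of_sum_range_le (c := dist (z 1) (z 0) + θ 1) (fun _ => dist_nonneg) fun n => ?_
  linarith [(key n).2, hθ (n + 1), dist_nonneg (x := z (n + 1)) (y := z n)]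

theorem tendsto_norm_sub_of_decrease {E : Type*} [SeminormedAddCommGroup E] {z : ℕ → E} {ψ : ℕ → ℝ}
    {a ζ : ℝ} (ha : 0 < a) (hζ : Tendsto ψ atTop (𝓝 ζ))
    (hdec : ∀ k, a * ‖z (k + 1) - z k‖ ^ 2 ≤ ψ k - ψ (k + 1)) :
    Tendsto (fun k => ‖z (k + 1) - z k‖) atTop (𝓝 0) := by
  have h1 : Tendsto (fun k => (ψ k - ψ (k + 1)) / a) atTop (𝓝 0) := by
    simpa using (hζ.sub (hζ.comp (tendsto_add_atTop_nat 1))).div_const a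
  have h2 : Tendsto (fun k => ‖z (k + 1) - z k‖ ^ 2) atTop (𝓝 0) :=
    squeeze_zero (fun _ => sq_nonneg _)
      (fun k => by rw [le_div_iff₀ ha]; linarith [hdec k]) h1
  simpa using h2.sqrt

/-- The one-step consequence of the Kurdyka–Łojasiewicz inequality for a sequence with sufficient
decrease `a * d' ^ 2` and relative error `C * d`. -/
theorem IsDesingularizing.two_mul_le {E : Type*} [SeminormedAddCommGroup E] {η : ℝ} {φ : ℝ → ℝ}
    (hφ : IsDesingularizing η φ) {S : Set E} {a C d d' r r' : ℝ} (ha : 0 < a) (hC : 0 ≤ C) (hd : 0 ≤ d)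
    (hr' : 0 ≤ r') (hrη : r < η) (hdec : a * d' ^ 2 ≤ r - r')
    (hKL : 0 < r → 1 ≤ ENNReal.ofReal (deriv φ r) * Metric.infEDist 0 S)
    (hS : ∃ v ∈ S, ‖v‖ ≤ C * d) :
    2 * d' ≤ d + (C / a * φ r - C / a * φ r') := by
  have hr'r : r' ≤ r := by nlinarith [sq_nonneg d']
  rcases (hr'.trans hr'r).eq_or_lt with hr | hr
  -- At `r = 0` the KL inequality says nothing, but sufficient decrease forces `d' = 0`.
  · obtain rfl : r' = r := by linarith
    have : d' ^ 2 = 0 := by nlinarith [sq_nonneg d']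
    rw [pow_eq_zero_iff two_ne_zero] at this
    subst this
    linarith
  have hpos := hφ.deriv_pos r ⟨hr, hrη⟩
  have hconc := hφ.deriv_mul_sub_le ⟨hr, hrη⟩ hr' hr'r
  obtain ⟨v, hvS, hv⟩ := hS
  have h1 : 1 ≤ deriv φ r * (C * d) := by
    have h2 : Metric.infEDist 0 S ≤ ENNReal.ofReal (C * d) := by
      refine (Metric.infEDist_le_edist_of_mem hvS).trans ?_
      rw [edist_dist, dist_zero_left]
      exact ENNReal.ofReal_le_ofReal hv
    have h3 := (hKL hr).trans (mul_le_mul_right h2 _)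
    rwa [← ENNReal.ofReal_mul hpos.le, ENNReal.one_le_ofReal] at h3
  set Δ := φ r - φ r' with hΔ
  have h4 : a * d' ^ 2 ≤ C * d * Δ := by
    calc a * d' ^ 2 ≤ a * d' ^ 2 * (deriv φ r * (C * d)) :=
          le_mul_of_one_le_right (by positivity) h1
      _ ≤ (r - r') * (deriv φ r * (C * d)) := by gcongr
      _ = C * d * (deriv φ r * (r - r')) := by ring
      _ ≤ C * d * Δ := by gcongr
  have hΔ0 : 0 ≤ Δ := le_trans (mul_nonneg hpos.le (by linarith)) hconc
  have h5 : d' ^ 2 ≤ d * (C / a * Δ) := by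
    have : d * (C / a * Δ) = C * d * Δ / a := by ring
    rw [this, le_div_iff₀ ha]
    linarith
  have h6 : 0 ≤ C / a * Δ := by positivity
  rw [← mul_sub, ← hΔ]
  -- AM-GM: `4 * d * t ≤ (d + t) ^ 2` with `t = C / a * Δ`.
  exact le_of_sq_le_sq (by nlinarith [sq_nonneg (d - C / a * Δ)]) (by positivity)

/-- Convergence of a bounded sequence with sufficient decrease and relative error for a KL function,
provided that the function values converge along convergent subsequences. -/
theorem summable_and_tendsto_of_isKLFunction {E : Type*} [NormedAddCommGroup E]
    [InnerProductSpace ℝ E] [ProperSpace E] {Ψ : E → ℝ} {z v : ℕ → E}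
    (hKL : IsKLFunction Ψ) {a C : ℝ} (ha : 0 < a) (hC : 0 ≤ C)
    (hbdd : Bornology.IsBounded (range z)) {ζ : ℝ}
    (hζ : Tendsto (fun k => Ψ (z k)) atTop (𝓝 ζ))
    (hdec : ∀ k, a * ‖z (k + 1) - z k‖ ^ 2 ≤ Ψ (z k) - Ψ (z (k + 1)))
    (hv : ∀ k, v k ∈ frechetSubdifferential Ψ (z (k + 1)))
    (hvC : ∀ k, ‖v k‖ ≤ C * ‖z (k + 1) - z k‖)
    (hcont : ∀ (w : E) (σ : ℕ → ℕ), StrictMono σ → Tendsto (z ∘ σ) atTop (𝓝 w) → Ψ w = ζ) :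
    Summable (fun k => ‖z (k + 1) - z k‖) ∧
      ∃ w ∈ criticalPoints Ψ, Tendsto z atTop (𝓝 w) := by
  have hanti : Antitone fun k => Ψ (z k) :=
    antitone_nat_of_succ_le fun k => by nlinarith [hdec k, sq_nonneg ‖z (k + 1) - z k‖]
  have hge : ∀ k, ζ ≤ Ψ (z k) := hanti.le_of_tendsto hζ
  have hstep0 : Tendsto (fun k => ‖z (k + 1) - z k‖) atTop (𝓝 0) :=
    tendsto_norm_sub_of_decrease ha hζ hdec
  have hv0 : Tendsto v atTop (𝓝 0) := by
    refine squeeze_zero_norm hvC ?_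
    simpa using hstep0.const_mul C
  obtain ⟨w, -, σ, hσ, hw⟩ := tendsto_subseq_of_bounded hbdd (fun k => mem_range_self k)
  have hΨw : Ψ w = ζ := hcont w σ hσ hw
  have hshift : Tendsto (fun j => z (σ j + 1)) atTop (𝓝 w) := by
    have := hw.add ((tendsto_zero_iff_norm_tendsto_zero.2 hstep0).comp hσ.tendsto_atTop)
    simpa [Function.comp_def] using this
  have hcrit : w ∈ criticalPoints Ψ :=
    ⟨fun j => z (σ j + 1), fun j => v (σ j), hshift,
      hΨw ▸ (hζ.comp (tendsto_add_atTop_nat 1)).comp hσ.tendsto_atTop, fun j => hv _,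
      hv0.comp hσ.tendsto_atTop⟩
  obtain ⟨η, hη, S, hS, φ, hφ, hineq⟩ := hKL w ⟨0, hcrit⟩
  rw [hΨw] at hineq
  obtain ⟨ρ, hρ, hball⟩ := Metric.mem_nhds_iff.1 hS
  have hr0 : Tendsto (fun k => Ψ (z k) - ζ) atTop (𝓝 0) := by
    simpa using hζ.sub_const ζ
  have hrη : ∀ᶠ k in atTop, Ψ (z k) - ζ < η := hr0.eventually_lt_const hη
  have hφ0 : Tendsto (fun k => φ (Ψ (z k) - ζ)) atTop (𝓝 0) := by
    have h1 : Tendsto φ (𝓝[Ico 0 η] 0) (𝓝 0) := by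
      simpa [ContinuousWithinAt, hφ.map_zero] using hφ.continuousOn 0 ⟨le_rfl, hη⟩
    refine h1.comp (tendsto_nhdsWithin_iff.2 ⟨hr0, ?_⟩)
    filter_upwards [hrη] with k hk using ⟨sub_nonneg.2 (hge k), hk⟩
  have hstart : ∀ᶠ j in atTop, dist (z (σ j + 1)) w + dist (z (σ j + 1)) (z (σ j)) +
      C / a * φ (Ψ (z (σ j + 1)) - ζ) < ρ := by
    have h1 := tendsto_iff_dist_tendsto_zero.1 hshift
    have h2 := hstep0.comp hσ.tendsto_atTop
    have h3 := (((hφ0.comp (tendsto_add_atTop_nat 1)).comp hσ.tendsto_atTop).const_mul (C / a))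
    have h4 := (h1.add h2).add h3
    simp only [mul_zero, add_zero] at h4
    simpa [Function.comp_def, dist_eq_norm] using h4.eventually_lt_const hρ
  -- The sequence is restarted at `σ j`, late enough for the trapping condition to hold and for all
  -- later values to lie within `η` of `ζ`.
  obtain ⟨j, hj, hjη⟩ := (hstart.and (hσ.tendsto_atTop.eventually hrη)).exists
  have hη' : ∀ k, Ψ (z (k + σ j)) - ζ < η := fun k =>
    lt_of_le_of_lt (sub_le_sub_right (hanti (Nat.le_add_left _ _)) _) hjη
  have hsum : Summable fun k => ‖z (k + 1) - z k‖ := by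
    rw [← summable_nat_add_iff (σ j)]
    have := summable_dist_of_trapped (z := fun k => z (k + σ j)) (w := w) (ρ := ρ)
      (θ := fun k => C / a * φ (Ψ (z (k + σ j)) - ζ))
      (fun k => mul_nonneg (by positivity) (hφ.nonneg _ ⟨sub_nonneg.2 (hge _), hη' k⟩))
      (by simpa [add_comm] using hj) (fun k hk => ?_)
    · simpa [dist_eq_norm, add_right_comm] using this
    · have e1 : k + 1 + σ j = k + σ j + 1 := by ring
      have e2 : k + 2 + σ j = k + σ j + 1 + 1 := by ring
      have hηk := hη' (k + 1)
      simp only [e1, e2, dist_eq_norm] at hk hηk ⊢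
      refine hφ.two_mul_le ha hC (norm_nonneg _) (sub_nonneg.2 (hge _)) hηk
        (by simpa using hdec (k + σ j + 1)) (fun hpos => ?_)
        ⟨v (k + σ j), frechetSubdifferential_subset_limitingSubdifferential _ _ (hv _), hvC _⟩
      exact hineq _ (hball (by simpa [dist_eq_norm] using hk)) (by linarith) (by linarith)
  refine ⟨hsum, w, hcrit, tendsto_nhds_of_cauchySeq_of_subseq ?_ hσ.tendsto_atTop hw⟩
  refine cauchySeq_of_summable_dist ?_
  simpa [dist_eq_norm, norm_sub_rev] using hsum

end Convergence

/-! ### Calculus on the product space -/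

section Product

theorem lowerSemicontinuous_objective {E F : Type*} [NormedAddCommGroup E] [NormedAddCommGroup F]
    {f : E → ℝ} {g : F → ℝ} {H : WithLp 2 (E × F) → ℝ}
    (hf : LowerSemicontinuous f) (hg : LowerSemicontinuous g) (hH : Continuous H) :
    LowerSemicontinuous (objective f g H) :=
  ((hf.comp (WithLp.continuous_fst 2 E F)).add
    (hg.comp (WithLp.continuous_snd 2 E F))).add hH.lowerSemicontinuous

variable {E F : Type*} [NormedAddCommGroup E] [InnerProductSpace ℝ E]
  [NormedAddCommGroup F] [InnerProductSpace ℝ F]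

theorem gradFst_eq [CompleteSpace E] [CompleteSpace F] {H : WithLp 2 (E × F) → ℝ}
    (hH : Differentiable ℝ H) (x : E) (y : F) :
    gradFst H x y = (gradient H (WithLp.toLp 2 (x, y))).fst := by
  refine HasGradientAt.gradient ?_
  rw [hasGradientAt_iff_hasFDerivAt]
  have h1 : HasFDerivAt (fun x' : E => WithLp.toLp 2 (x', y))
      (((WithLp.prodContinuousLinearEquiv 2 ℝ E F).symm : E × F →L[ℝ] WithLp 2 (E × F)).comp
        (ContinuousLinearMap.inl ℝ E F)) x :=
    (WithLp.prodContinuousLinearEquiv 2 ℝ E F).symm.hasFDerivAt.comp x (hasFDerivAt_prodMk_left x y)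
  refine ((hH _).hasGradientAt.hasFDerivAt.comp x h1).congr_fderiv ?_
  ext u
  change inner ℝ (gradient H (WithLp.toLp 2 (x, y))) (WithLp.toLp 2 (u, 0)) = inner ℝ _ u
  rw [WithLp.prod_inner_apply]
  simp

theorem gradSnd_eq [CompleteSpace E] [CompleteSpace F] {H : WithLp 2 (E × F) → ℝ}
    (hH : Differentiable ℝ H) (x : E) (y : F) :
    gradSnd H x y = (gradient H (WithLp.toLp 2 (x, y))).snd := by
  refine HasGradientAt.gradient ?_
  rw [hasGradientAt_iff_hasFDerivAt]
  have h1 : HasFDerivAt (fun y' : F => WithLp.toLp 2 (x, y'))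
      (((WithLp.prodContinuousLinearEquiv 2 ℝ E F).symm : E × F →L[ℝ] WithLp 2 (E × F)).comp
        (ContinuousLinearMap.inr ℝ E F)) y :=
    (WithLp.prodContinuousLinearEquiv 2 ℝ E F).symm.hasFDerivAt.comp y
      (hasFDerivAt_prodMk_right x y)
  refine ((hH _).hasGradientAt.hasFDerivAt.comp y h1).congr_fderiv ?_
  ext u
  change inner ℝ (gradient H (WithLp.toLp 2 (x, y))) (WithLp.toLp 2 (0, u)) = inner ℝ _ u
  rw [WithLp.prod_inner_apply]
  simp

/-- Proximal points `p`, `q` of `f` and `g` yield a Fréchet subgradient of the objective. -/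
theorem add_gradient_mem_frechetSubdifferential [CompleteSpace E] [CompleteSpace F]
    {f : E → ℝ} {g : F → ℝ} {H : WithLp 2 (E × F) → ℝ} {c : ℝ} (hc : 0 < c) {p w₁ : E} {q w₂ : F}
    (hH : DifferentiableAt ℝ H (WithLp.toLp 2 (p, q)))
    (hp : p ∈ prox (c • f) w₁) (hq : q ∈ prox (c • g) w₂) :
    c⁻¹ • WithLp.toLp 2 (w₁ - p, w₂ - q) + gradient H (WithLp.toLp 2 (p, q)) ∈
      frechetSubdifferential (objective f g H) (WithLp.toLp 2 (p, q)) := by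
  refine mem_frechetSubdifferential_of_eventually fun ε hε => ?_
  have hlit := (hasGradientAt_iff_isLittleO.1 hH.hasGradientAt).bound (half_pos hε)
  -- Half of `ε` pays for the Taylor remainder of `H`, the other half for the quadratic prox terms,
  -- which radius `c * ε` makes small enough.
  filter_upwards [hlit, Metric.ball_mem_nhds (WithLp.toLp 2 (p, q)) (mul_pos hc hε)] with u hu hball
  have h1 := le_of_mem_prox hc hp u.fst
  have h2 := le_of_mem_prox hc hq u.snd
  have h3 := neg_le_of_abs_le hu
  have h4 := WithLp.prod_norm_sq_eq_of_L2 (u - WithLp.toLp 2 (p, q))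
  have h5 : c⁻¹ / 2 * ‖u - WithLp.toLp 2 (p, q)‖ ^ 2 ≤ ε / 2 * ‖u - WithLp.toLp 2 (p, q)‖ := by
    rw [Metric.mem_ball, dist_eq_norm] at hball
    have : c⁻¹ * ‖u - WithLp.toLp 2 (p, q)‖ ≤ ε := by
      rw [inv_mul_le_iff₀ hc]
      exact hball.le
    nlinarith [norm_nonneg (u - WithLp.toLp 2 (p, q))]
  rw [h4] at h5
  rw [inner_add_left, WithLp.prod_inner_apply (c⁻¹ • _)]
  simp only [objective, WithLp.sub_fst, WithLp.sub_snd, WithLp.smul_fst, WithLp.smul_snd,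
    WithLp.toLp_fst, WithLp.toLp_snd, WithLp.ofLp_fst, WithLp.ofLp_snd] at h1 h2 h3 h5 ⊢
  linarith

/-- If `p j` are proximal points of `f` at converging centres and `p j → u`, then `f (p j)` is
bounded by `f u` up to a vanishing error. -/
theorem exists_tendsto_le_of_mem_prox {f : E → ℝ} {c : ℝ} (hc : 0 < c) {p w : ℕ → E} {u w₀ : E}
    (hp : ∀ j, p j ∈ prox (c • f) (w j)) (hpu : Tendsto p atTop (𝓝 u))
    (hw : Tendsto w atTop (𝓝 w₀)) :
    ∃ e : ℕ → ℝ, Tendsto e atTop (𝓝 0) ∧ ∀ j, f (p j) ≤ f u + e j := by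
  refine ⟨fun j => c⁻¹ / 2 * ‖u - p j‖ ^ 2 - inner ℝ (c⁻¹ • (w j - p j)) (u - p j), ?_,
    fun j => by linarith [le_of_mem_prox hc (hp j) u]⟩
  have h1 : Tendsto (fun j => u - p j) atTop (𝓝 0) := by simpa using hpu.const_sub u
  have h2 := ((h1.norm.pow 2).const_mul (c⁻¹ / 2)).sub
    (((hw.sub hpu).const_smul c⁻¹).inner (𝕜 := ℝ) h1)
  simpa using h2

end Product

/-! ### Estimates for one iteration -/

section Iteration

variable {E F : Type*} [NormedAddCommGroup E] [InnerProductSpace ℝ E] [CompleteSpace E]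
  [NormedAddCommGroup F] [InnerProductSpace ℝ F] [CompleteSpace F]
  {f : E → ℝ} {g : F → ℝ} {H : WithLp 2 (E × F) → ℝ} {l : NNReal} {τ : ℝ}
  {x x' : E} {y y' : F}

/-- The descent lemma is applied to each block move, through `(x', y)`. Its linear terms cancel
those of the two prox inequalities. -/
theorem objective_decrease (hH : Differentiable ℝ H) (hl : LipschitzWith l (gradient H))
    (hτ : 0 < τ) (hx : x' ∈ prox (τ • f) (x - τ • gradFst H x y))
    (hy : y' ∈ prox (τ • g) (y - τ • gradSnd H x' y)) :
    (τ⁻¹ - l) / 2 * ‖WithLp.toLp 2 (x', y') - WithLp.toLp 2 (x, y)‖ ^ 2 ≤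
      objective f g H (WithLp.toLp 2 (x, y)) - objective f g H (WithLp.toLp 2 (x', y')) := by
  have h1 := prox_gradient_decrease hτ hx
  have h2 := prox_gradient_decrease hτ hy
  have h3 := le_add_inner_gradient_add_sq hH hl (WithLp.toLp 2 (x, y)) (WithLp.toLp 2 (x', y))
  have h4 := le_add_inner_gradient_add_sq hH hl (WithLp.toLp 2 (x', y)) (WithLp.toLp 2 (x', y'))
  rw [gradFst_eq hH] at h1
  rw [gradSnd_eq hH] at h2
  rw [WithLp.prod_norm_sq_eq_of_L2, WithLp.prod_inner_apply] at h3 h4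
  rw [WithLp.prod_norm_sq_eq_of_L2]
  simp only [objective, WithLp.sub_fst, WithLp.sub_snd, WithLp.toLp_fst, WithLp.toLp_snd,
    WithLp.ofLp_fst, WithLp.ofLp_snd, sub_self, inner_zero_right, norm_zero] at h3 h4 ⊢
  linarith

theorem exists_subgradient_norm_le (hH : Differentiable ℝ H) (hl : LipschitzWith l (gradient H))
    (hτ : 0 < τ) (hx : x' ∈ prox (τ • f) (x - τ • gradFst H x y))
    (hy : y' ∈ prox (τ • g) (y - τ • gradSnd H x' y)) :
    ∃ v ∈ frechetSubdifferential (objective f g H) (WithLp.toLp 2 (x', y')),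
      ‖v‖ ≤ (τ⁻¹ + 2 * l) * ‖WithLp.toLp 2 (x', y') - WithLp.toLp 2 (x, y)‖ := by
  refine ⟨_, add_gradient_mem_frechetSubdifferential hτ (hH _) hx hy, ?_⟩
  set z := WithLp.toLp 2 (x, y) with hz
  set z' := WithLp.toLp 2 (x', y') with hz'
  set m := WithLp.toLp 2 (x', y) with hm
  set G := gradient H with hG
  -- The gradients used by the algorithm are taken at `z` and at the half-updated point `m`, so two
  -- gradient differences remain, each costing `l` times the step.
  have e : τ⁻¹ • WithLp.toLp 2 (x - τ • gradFst H x y - x', y - τ • gradSnd H x' y - y') + G z' =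
      τ⁻¹ • (z - z') + (WithLp.toLp 2 ((G z' - G z).fst, 0) +
        WithLp.toLp 2 (0, (G z' - G m).snd)) := by
    rw [gradFst_eq hH, gradSnd_eq hH]
    apply (WithLp.equiv 2 (E × F)).injective
    ext
    · simp [hz, hz', hm, hG, smul_sub, smul_smul, inv_mul_cancel₀ hτ.ne']
      abel
    · simp [hz, hz', hm, hG, smul_sub, smul_smul, inv_mul_cancel₀ hτ.ne']
      abel
  have h1 : ‖WithLp.toLp 2 ((G z' - G z).fst, (0 : F))‖ ≤ l * ‖z' - z‖ := by
    rw [WithLp.norm_toLp_fst]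
    refine (WithLp.norm_fst_le _ _).trans ?_
    simpa [dist_eq_norm] using hl.dist_le_mul z' z
  have h2 : ‖WithLp.toLp 2 ((0 : E), (G z' - G m).snd)‖ ≤ l * ‖z' - z‖ := by
    rw [WithLp.norm_toLp_snd]
    refine (WithLp.norm_snd_le _ _).trans ?_
    have h3 : ‖z' - m‖ ≤ ‖z' - z‖ := by
      have h4 : z' - m = WithLp.toLp 2 ((0 : E), (z' - z).snd) := by
        apply (WithLp.equiv 2 (E × F)).injective
        ext <;> simp [hz, hz', hm]
      rw [h4, WithLp.norm_toLp_snd]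
      exact WithLp.norm_snd_le _ _
    have h5 := hl.dist_le_mul z' m
    rw [dist_eq_norm, dist_eq_norm] at h5
    exact h5.trans (by gcongr)
  rw [e]
  refine (norm_add_le_of_le (le_of_eq ?_) (norm_add_le_of_le h1 h2)).trans
    (le_of_eq (a := τ⁻¹ * ‖z' - z‖ + (l * ‖z' - z‖ + l * ‖z' - z‖)) (by ring))
  rw [norm_smul, norm_sub_rev, Real.norm_of_nonneg (inv_nonneg.2 hτ.le)]

/-- Function values converge to the value at the limit along convergent subsequences. -/
theorem objective_eq_of_tendsto_subseq (hf : LowerSemicontinuous f) (hg : LowerSemicontinuous g)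
    (hH : Differentiable ℝ H) (hl : LipschitzWith l (gradient H)) (hτ : 0 < τ)
    {x : ℕ → E} {y : ℕ → F} {z : ℕ → WithLp 2 (E × F)} (hz : ∀ k, z k = WithLp.toLp 2 (x k, y k))
    (hx : ∀ k, x (k + 1) ∈ prox (τ • f) (x k - τ • gradFst H (x k) (y k)))
    (hy : ∀ k, y (k + 1) ∈ prox (τ • g) (y k - τ • gradSnd H (x (k + 1)) (y k)))
    (hstep : Tendsto (fun k => ‖z (k + 1) - z k‖) atTop (𝓝 0)) {ζ : ℝ}
    (hζ : Tendsto (fun k => objective f g H (z k)) atTop (𝓝 ζ))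
    {w : WithLp 2 (E × F)} {σ : ℕ → ℕ} (hσ : StrictMono σ) (hw : Tendsto (z ∘ σ) atTop (𝓝 w)) :
    objective f g H w = ζ := by
  have hG : Continuous (gradient H) := hl.continuous
  have hfst := WithLp.continuous_fst 2 E F
  have hsnd := WithLp.continuous_snd 2 E F
  have hxz : ∀ k, x k = (z k).fst := fun k => by simp [hz k]
  have hyz : ∀ k, y k = (z k).snd := fun k => by simp [hz k]
  have hw' : Tendsto (fun j => z (σ j + 1)) atTop (𝓝 w) := by
    have := hw.add ((tendsto_zero_iff_norm_tendsto_zero.2 hstep).comp hσ.tendsto_atTop)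
    simpa [Function.comp_def] using this
  have hx0 : Tendsto (fun j => x (σ j)) atTop (𝓝 w.fst) := by
    simpa only [hxz, Function.comp_def] using (hfst.tendsto w).comp hw
  have hy0 : Tendsto (fun j => y (σ j)) atTop (𝓝 w.snd) := by
    simpa only [hyz, Function.comp_def] using (hsnd.tendsto w).comp hw
  have hx1 : Tendsto (fun j => x (σ j + 1)) atTop (𝓝 w.fst) := by
    simpa only [hxz, Function.comp_def] using (hfst.tendsto w).comp hw'
  have hy1 : Tendsto (fun j => y (σ j + 1)) atTop (𝓝 w.snd) := by
    simpa only [hyz, Function.comp_def] using (hsnd.tendsto w).comp hw'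
  have hm : Tendsto (fun j => WithLp.toLp 2 (x (σ j + 1), y (σ j))) atTop (𝓝 w) :=
    ((WithLp.prod_continuous_toLp 2 E F).tendsto (w.fst, w.snd)).comp (hx1.prodMk_nhds hy0)
  have hgx : Tendsto (fun j => gradFst H (x (σ j)) (y (σ j))) atTop (𝓝 (gradient H w).fst) := by
    simp only [gradFst_eq hH, ← hz]
    exact ((hfst.comp hG).tendsto w).comp hw
  have hgy : Tendsto (fun j => gradSnd H (x (σ j + 1)) (y (σ j))) atTop
      (𝓝 (gradient H w).snd) := by
    simp only [gradSnd_eq hH]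
    exact ((hsnd.comp hG).tendsto w).comp hm
  obtain ⟨e₁, he₁, hfe⟩ := exists_tendsto_le_of_mem_prox hτ (fun j => hx (σ j)) hx1
    (hx0.sub (hgx.const_smul τ))
  obtain ⟨e₂, he₂, hge⟩ := exists_tendsto_le_of_mem_prox hτ (fun j => hy (σ j)) hy1
    (hy0.sub (hgy.const_smul τ))
  have hζ' : Tendsto (fun j => objective f g H (z (σ j + 1))) atTop (𝓝 ζ) :=
    (hζ.comp (tendsto_add_atTop_nat 1)).comp hσ.tendsto_atTop
  apply le_antisymm
  -- Lower semicontinuity gives this direction.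
  · refine le_of_forall_lt fun a ha => ?_
    obtain ⟨b, hab, hb⟩ := exists_between ha
    refine hab.trans_le (ge_of_tendsto hζ' ?_)
    filter_upwards [hw'.eventually
      (lowerSemicontinuous_objective hf hg hH.continuous w b hb)] with j hj using hj.le
  -- For the converse, each prox point is compared with the limit `w` as competitor.
  · have hlim := ((he₁.const_add (f w.fst)).add (he₂.const_add (g w.snd))).add
      ((hH.continuous.tendsto w).comp hw')
    simp only [add_zero] at hlim
    refine le_of_tendsto_of_tendsto' hζ' hlim fun j => ?_
    have h1 := hfe j
    have h2 := hge j
    rw [hxz] at h1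
    rw [hyz] at h2
    simp only [objective, Function.comp_apply]
    linarith

end Iteration

end PALM

theorem mainTheorem1 {E F : Type*}
    [NormedAddCommGroup E] [InnerProductSpace ℝ E] [CompleteSpace E] [FiniteDimensional ℝ E]
    [NormedAddCommGroup F] [InnerProductSpace ℝ F] [CompleteSpace F] [FiniteDimensional ℝ F]
    (f : E → ℝ) (g : F → ℝ) (H : WithLp 2 (E × F) → ℝ)
    (hf : LowerSemicontinuous f) (hf_bdd : BddBelow (Set.range f))
    (hg : LowerSemicontinuous g) (hg_bdd : BddBelow (Set.range g))
    (l : NNReal) (hl : 0 < l)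
    (hH : Differentiable ℝ H) (hH_lip : LipschitzWith l (gradient H))
    (hKL : PALM.IsKLFunction (PALM.objective f g H))
    (γ : ℝ) (hγ : 1 < γ) (c d : ℕ → ℝ)
    (hc : ∀ k, c k = 1 / (γ * l)) (hd : ∀ k, d k = 1 / (γ * l))
    (x : ℕ → E) (y : ℕ → F) (hxy : PALM.IsIteration f g H c d x y)
    (z : ℕ → WithLp 2 (E × F)) (hz : ∀ k, z k = WithLp.toLp 2 (x k, y k))
    (hz_bdd : Bornology.IsBounded (Set.range z)) :
    Summable (fun k => ‖z (k + 1) - z k‖) ∧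
      ∃ z_lim ∈ PALM.criticalPoints (PALM.objective f g H),
        Filter.Tendsto z Filter.atTop (nhds z_lim) := by
  have hl' : (0 : ℝ) < l := by exact_mod_cast hl
  set τ : ℝ := 1 / (γ * l) with hτ_def
  have hτ : 0 < τ := by positivity
  have hτ_inv : τ⁻¹ = γ * l := by rw [hτ_def, one_div, inv_inv]
  have hx : ∀ k, x (k + 1) ∈ PALM.prox (τ • f) (x k - τ • PALM.gradFst H (x k) (y k)) :=
    fun k => by simpa only [hc] using hxy.step_fst k
  have hy : ∀ k, y (k + 1) ∈ PALM.prox (τ • g) (y k - τ • PALM.gradSnd H (x (k + 1)) (y k)) :=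
    fun k => by simpa only [hd] using hxy.step_snd k
  have ha : 0 < (τ⁻¹ - l) / 2 := by
    rw [hτ_inv]
    nlinarith
  have hdec : ∀ k, (τ⁻¹ - l) / 2 * ‖z (k + 1) - z k‖ ^ 2 ≤
      PALM.objective f g H (z k) - PALM.objective f g H (z (k + 1)) := fun k => by
    rw [hz, hz]
    exact PALM.objective_decrease hH hH_lip hτ (hx k) (hy k)
  have hanti : Antitone fun k => PALM.objective f g H (z k) :=
    antitone_nat_of_succ_le fun k => by nlinarith [hdec k, sq_nonneg ‖z (k + 1) - z k‖]
  have hbelow : BddBelow (Set.range fun k => PALM.objective f g H (z k)) := by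
    -- `H` may be unbounded below, but a lower semicontinuous function is bounded below on the
    -- compact closure of the orbit.
    refine (((PALM.lowerSemicontinuous_objective hf hg hH.continuous).lowerSemicontinuousOn
      _).bddBelow_of_isCompact hz_bdd.isCompact_closure).mono ?_
    rintro _ ⟨k, rfl⟩
    exact ⟨z k, subset_closure ⟨k, rfl⟩, rfl⟩
  have hζ := tendsto_atTop_ciInf hanti hbelow
  have hv : ∀ k, ∃ v ∈ PALM.frechetSubdifferential (PALM.objective f g H) (z (k + 1)),
      ‖v‖ ≤ (τ⁻¹ + 2 * l) * ‖z (k + 1) - z k‖ := fun k => by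
    rw [hz, hz]
    exact PALM.exists_subgradient_norm_le hH hH_lip hτ (hx k) (hy k)
  choose v hv hvC using hv
  exact PALM.summable_and_tendsto_of_isKLFunction hKL ha (by positivity) hz_bdd hζ hdec hv hvC
    fun w σ hσ hw => PALM.objective_eq_of_tendsto_subseq hf hg hH hH_lip hτ hz hx hy
      (PALM.tendsto_norm_sub_of_decrease ha hζ hdec) hζ hσ hw
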